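/- Let $\mathcal C$ be a sum closed permutation class: a set of finite permutations that is closed under taking patterns and under direct sums $\sigma\oplus\tau$. Let $\mathcal C_n$ be the set of its elements of size $n$. A permutation of positive size is indecomposable if it is not the direct sum of two permutations of positive size. An affine permutation of size $n\ge 1$ is a bijection $\omega:\mathbb Z\to\mathbb Z$ with $\omega(i+n)=\omega(i)+n$ for all $i$ and $\sum_{i=1}^n\omega(i)=\sum_{i=1}^n i$. For $\pi\in\mathcal C_n$ with $n\ge1$, let $\oplus\pi$ be the affine permutation of size $n$ with $\oplus\pi(i+kn)=\pi(i)+kn$ for $1\le i\le n$, $k\in\mathbb Z$. For $r\in\mathbb Z$ and an affine permutation $\omega$, let $\Sigma^r\omega(i)=\omega(i-r)+r$. Let $\oplus\mathcal C_n=\{\Sigma^r(\oplus\pi):\pi\in\mathcal C_n,\ r\in\mathbb Z\}$. Put $f_n=|\mathcal C_n|$ and $\widetilde f_n=|\oplus\mathcal C_n|$, let $g_n$ be the number of indecomposable elements of $\mathcal C_n$, and set $F(x)=\sum_{n\ge0}f_nx^n$ and $G(x)=\sum_{n\ge1}g_nx^n$. Assume: (1) (supercritical) the radius of convergence $R\in(0,\infty]$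 of $G$ is positive and $\lim_{x\to R^-}G(x)>1$, the limit being taken in the extended reals; (2) (aperiodic) there are no integers $m\ge0$, $d\ge2$ and power series $H$ with $G(x)=x^mH(x^d)$. Then $G(x)=1$ has a unique positive root $\rho$; it satisfies $\rho<R$ and is the radius of convergence of $F$. With $\alpha^{-1}=\rho\,G'(\rho)$, as $n\to\infty$, $$\widetilde f_n\ \sim\ \alpha^{-1}f_n\ \sim\ \rho^{-n}.$$ -/

import Mathlib

noncomputable section

namespace AffinePermutation

/-! ### Ordinary permutations and permutation classes -/

/-- A (finite) permutation together with its size. Position `i : Fin n` (and value `i : Fin n`)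
stands for the element `i + 1` of `{1, ..., n}`. -/
abbrev FinPerm : Type := Σ n : ℕ, Equiv.Perm (Fin n)

/-- `π` contains `τ` as a pattern: some subsequence of `π` is order-isomorphic to `τ`. -/
def Contains (π τ : FinPerm) : Prop :=
  ∃ φ : Fin τ.1 ↪o Fin π.1, ∀ i j, π.2 (φ i) < π.2 (φ j) ↔ τ.2 i < τ.2 j

/-- A permutation class is a set of permutations closed under taking patterns. -/
def IsPermClass (C : Set FinPerm) : Prop :=
  ∀ π ∈ C, ∀ τ, Contains π τ → τ ∈ C

/-- The sum `σ ⊕ τ`: it acts as `σ` on the first `a` positions, and as `τ`, translated by `a`,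
on the last `b` positions. -/
def permSum (σ τ : FinPerm) : FinPerm :=
  ⟨σ.1 + τ.1, finSumFinEquiv.permCongr (Equiv.Perm.sumCongr σ.2 τ.2)⟩

/-- A set of permutations is sum closed if it contains the sum of any two of its elements. -/
def SumClosed (C : Set FinPerm) : Prop :=
  ∀ σ ∈ C, ∀ τ ∈ C, permSum σ τ ∈ C

/-- A permutation of positive size is (sum-)indecomposable if it is not the sum of two
permutations of non-zero size. -/
def Indecomposable (π : FinPerm) : Prop :=
  0 < π.1 ∧ ¬ ∃ σ τ : FinPerm, 0 < σ.1 ∧ 0 < τ.1 ∧ π = permSum σ τ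

/-- The set of indecomposable elements of `C`. -/
def indec (C : Set FinPerm) : Set FinPerm := {π ∈ C | Indecomposable π}

/-- The number of elements of size `n` in `C`. -/
def count (C : Set FinPerm) (n : ℕ) : ℕ :=
  Set.ncard {π : Equiv.Perm (Fin n) | (⟨n, π⟩ : FinPerm) ∈ C}

/-! ### Affine permutations -/

/-- An affine permutation of size `n`. -/
@[ext]
structure AffinePerm (n : ℕ) where
  toPerm : Equiv.Perm ℤ
  periodic : ∀ i, toPerm (i + n) = toPerm i + n
  centered : ∑ i ∈ Finset.Icc (1 : ℤ) n, toPerm i = ∑ i ∈ Finset.Icc (1 : ℤ) n, i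

/-- The bijection of `ℤ` underlying the infinite sum `⊕ π`: writing `j = (i + 1) + k n` with
`i : Fin n`, it maps `j` to `(π i + 1) + k n`. -/
def infSumPerm {n : ℕ} [NeZero n] (π : Equiv.Perm (Fin n)) : Equiv.Perm ℤ :=
  (((Equiv.subRight (1 : ℤ)).trans (Int.divModEquiv n)).symm).permCongr
    (Equiv.prodCongr (Equiv.refl ℤ) π)

theorem infSumPerm_apply {n : ℕ} [NeZero n] (π : Equiv.Perm (Fin n)) (i : Fin n) (k : ℤ) :
    infSumPerm π (((i : ℕ) : ℤ) + 1 + k * n) = (((π i : Fin n) : ℕ) : ℤ) + 1 + k * n := by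
  have h : ((Equiv.subRight (1 : ℤ)).trans (Int.divModEquiv n)) (((i : ℕ) : ℤ) + 1 + k * n)
      = (k, i) := by
    rw [← Equiv.eq_symm_apply]
    simp
    ring
  simp only [infSumPerm, Equiv.permCongr_apply, Equiv.symm_symm, h]
  simp
  ring

theorem exists_eq_add_mul {n : ℕ} [NeZero n] (j : ℤ) :
    ∃ (i : Fin n) (k : ℤ), j = ((i : ℕ) : ℤ) + 1 + k * n := by
  refine ⟨(Int.divModEquiv n (j - 1)).2, (Int.divModEquiv n (j - 1)).1, ?_⟩
  have h := (Int.divModEquiv n).symm_apply_apply (j - 1)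
  rw [Int.divModEquiv_symm_apply] at h
  linarith

theorem sum_Icc_one (n : ℕ) (f : ℤ → ℤ) :
    ∑ i ∈ Finset.Icc (1 : ℤ) n, f i = ∑ k ∈ Finset.range n, f ((k : ℤ) + 1) := by
  symm
  refine Finset.sum_bij (fun k _ => (k : ℤ) + 1) ?_ ?_ ?_ ?_
  · intro k hk
    simp only [Finset.mem_range] at hk
    simp only [Finset.mem_Icc]
    omega
  · intro a _ b _ h
    simpa using h
  · intro b hb
    simp only [Finset.mem_Icc] at hb
    refine ⟨(b - 1).toNat, ?_, ?_⟩
    · simp only [Finset.mem_range]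
      omega
    · omega
  · intros
    rfl

/-- The infinite sum `⊕ π` of a permutation `π` of size `n ≥ 1`, as an affine permutation. -/
def infSum {n : ℕ} [NeZero n] (π : Equiv.Perm (Fin n)) : AffinePerm n where
  toPerm := infSumPerm π
  periodic j := by
    obtain ⟨i, k, rfl⟩ := exists_eq_add_mul (n := n) j
    have h : ((i : ℕ) : ℤ) + 1 + k * n + n = ((i : ℕ) : ℤ) + 1 + (k + 1) * n := by ring
    rw [h, infSumPerm_apply, infSumPerm_apply]
    ring
  centered := by
    rw [sum_Icc_one, sum_Icc_one, Finset.sum_range, Finset.sum_range]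
    have h : ∀ i : Fin n, infSumPerm π (((i : ℕ) : ℤ) + 1) = (((π i : Fin n) : ℕ) : ℤ) + 1 := by
      intro i
      simpa using infSumPerm_apply π i 0
    simp only [h]
    exact Equiv.sum_comp π (fun i : Fin n => ((i : ℕ) : ℤ) + 1)

theorem sum_shift {n : ℕ} (h : ℤ → ℤ) (hper : ∀ i, h (i + n) = h i) (r : ℤ) :
    ∑ k ∈ Finset.range n, h ((k : ℤ) + 1 - r) = ∑ k ∈ Finset.range n, h ((k : ℤ) + 1) := by
  have step : ∀ s : ℤ, ∑ k ∈ Finset.range n, h ((k : ℤ) + 1 + s)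
      = ∑ k ∈ Finset.range n, h ((k : ℤ) + s) := by
    intro s
    have h1 := Finset.sum_range_succ (fun k : ℕ => h ((k : ℤ) + s)) n
    have h2 := Finset.sum_range_succ' (fun k : ℕ => h ((k : ℤ) + s)) n
    have h3 := hper s
    rw [add_comm] at h3
    push_cast at h1 h2
    rw [zero_add] at h2
    linarith
  have key : ∀ s : ℤ, ∑ k ∈ Finset.range n, h ((k : ℤ) + s)
      = ∑ k ∈ Finset.range n, h (k : ℤ) := by
    intro s
    induction s using Int.induction_on with
    | zero => simp
    | succ m ih =>
      rw [← ih, ← step m]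
      refine Finset.sum_congr rfl fun k _ => ?_
      congr 1
      ring
    | pred m ih =>
      rw [← ih, ← step (-(m : ℤ) - 1)]
      refine Finset.sum_congr rfl fun k _ => ?_
      congr 1
      ring
  have := key (1 - r)
  rw [← key 1] at this
  simpa [add_sub_assoc] using this

/-- The shift `Σ^r σ` of an affine permutation `σ`, defined by `Σ^r σ (i) = σ (i - r) + r`. -/
def AffinePerm.shift {n : ℕ} (r : ℤ) (σ : AffinePerm n) : AffinePerm n where
  toPerm := ((Equiv.subRight r).trans σ.toPerm).trans (Equiv.addRight r)
  periodic i := by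
    have h : i + n - r = i - r + n := by ring
    simp [h, σ.periodic]
    ring
  centered := by
    have hc := σ.centered
    rw [sum_Icc_one, sum_Icc_one] at hc ⊢
    have hs := sum_shift (n := n) (fun i => σ.toPerm i - i)
      (fun i => by simp [σ.periodic]) r
    simp only [Finset.sum_sub_distrib] at hs
    simp only [Equiv.trans_apply, Equiv.subRight_apply, Equiv.coe_addRight,
      Finset.sum_add_distrib] at hs hc ⊢
    linarith

/-- The elements of size `n ≥ 1` of `⊕ C`: all shifts of infinite sums of the elements of size `n`
of `C`. -/
def infSumClass (C : Set FinPerm) (n : ℕ) [NeZero n] : Set (AffinePerm n) :=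
  {ω | ∃ π : Equiv.Perm (Fin n), (⟨n, π⟩ : FinPerm) ∈ C ∧
    ∃ r : ℤ, ω = AffinePerm.shift r (infSum π)}

/-- The number of elements of size `n` in `⊕ C`; affine permutations have positive size. -/
def affCount (C : Set FinPerm) : ℕ → ℕ
  | 0 => 0
  | n + 1 => Set.ncard (infSumClass C (n + 1))

/-! ### Generating functions -/

open PowerSeries

/-- The ordinary generating function of `C`. -/
def genFun (C : Set FinPerm) : PowerSeries ℝ := PowerSeries.mk fun n => (count C n : ℝ)

/-- The radius of convergence of a power series. -/
def radius (G : PowerSeries ℝ) : ENNReal :=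
  (FormalMultilinearSeries.ofScalars ℝ (fun n => coeff n G)).radius

/-- The function `x ↦ G(x)` defined by a power series (meaningful where the series converges). -/
def evalAt (G : PowerSeries ℝ) (x : ℝ) : ℝ := ∑' n, coeff n G * x ^ n

/-- The filter of real numbers tending to `r ∈ [0, ∞]` from below. -/
def fromBelow (r : ENNReal) : Filter ℝ :=
  Filter.comap Real.toEReal (nhdsWithin (r : EReal) (Set.Iio (r : EReal)))

/-- A sequence schema `F = 1 / (1 - G)` is supercritical if `G` has positive radius of convergence
`r ≤ ∞` and `τ = lim_{x → r⁻} G(x)`, a limit in the extended reals, satisfies `τ > 1`. -/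
def Supercritical (G : PowerSeries ℝ) : Prop :=
  0 < radius G ∧ ∃ τ : EReal,
    Filter.Tendsto (fun x : ℝ => (evalAt G x : EReal)) (fromBelow (radius G)) (nhds τ) ∧ 1 < τ

/-- `G` is aperiodic: it is not of the form `x ^ m * H (x ^ d)` with `m ≥ 0` and `d ≥ 2`. -/
def Aperiodic (G : PowerSeries ℝ) : Prop :=
  ¬ ∃ (m d : ℕ) (_ : 2 ≤ d) (hd : d ≠ 0) (H : PowerSeries ℝ), G = X ^ m * expand d hd H

end AffinePermutation

end

namespace AffinePermutation

/-! Cutting a permutation at its least positive cut splits off a unique indecomposable first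
summand, so `f n = ∑ g k * f (n - k)` for `n > 0` (`count_eq_sum_indec`). An element of `⊕ C` is
likewise determined by the indecomposable block covering position 1, the offset of position 1 within
that block (`k` choices for a block of size `k`), and the rest of one period. Hence the affine count
is `∑ k * g k * f (n - k)` (`affCount_eq_sum_indec`).

Supercriticality puts the root `ρ` of `G = 1` strictly inside the disc of convergence. Then `p k = g
k * ρ ^ k` is an aperiodic probability distribution with an exponential moment, and `u n = f n * ρ ^
n` is its renewal sequence. With `μ = ∑ k * p k = ρ G'(ρ)`, `tendsto_renewal` gives `u n → 1 / μ`.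
Convolving with `k * p k` multiplies the limit by `μ` (`tendsto_sum_nat_mul_renewal`), so the affine
count times `ρ ^ n` tends to 1. -/

/-! ### Sums, cuts and the first indecomposable summand. -/

theorem FinPerm.ext_nat {π τ : FinPerm} (h : π.1 = τ.1)
    (h' : ∀ (i : ℕ) (hi : i < π.1) (hi' : i < τ.1), (π.2 ⟨i, hi⟩ : ℕ) = τ.2 ⟨i, hi'⟩) : π = τ := by
  obtain ⟨n, π⟩ := π
  obtain ⟨m, τ⟩ := τ
  obtain rfl : n = m := h
  congr 1
  ext i
  exact h' i i.2 i.2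

theorem permSum_apply_left (σ τ : FinPerm) (i : ℕ) (hi : i < σ.1) (hi' : i < (permSum σ τ).1) :
    ((permSum σ τ).2 ⟨i, hi'⟩ : ℕ) = σ.2 ⟨i, hi⟩ := by
  change ((finSumFinEquiv.permCongr (Equiv.Perm.sumCongr σ.2 τ.2)) (Fin.castAdd τ.1 ⟨i, hi⟩) : ℕ) = _
  rw [Equiv.permCongr_apply, finSumFinEquiv_symm_apply_castAdd]
  simp

theorem permSum_apply_right (σ τ : FinPerm) (i : ℕ) (hi : i < τ.1)
    (hi' : σ.1 + i < (permSum σ τ).1) :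
    ((permSum σ τ).2 ⟨σ.1 + i, hi'⟩ : ℕ) = σ.1 + τ.2 ⟨i, hi⟩ := by
  change ((finSumFinEquiv.permCongr (Equiv.Perm.sumCongr σ.2 τ.2)) (Fin.natAdd σ.1 ⟨i, hi⟩) : ℕ) = _
  rw [Equiv.permCongr_apply, finSumFinEquiv_symm_apply_natAdd]
  simp

theorem permSum_fst (σ τ : FinPerm) : (permSum σ τ).1 = σ.1 + τ.1 := rfl

theorem contains_permSum_left (σ τ : FinPerm) : Contains (permSum σ τ) σ := by
  refine ⟨Fin.castAddOrderEmb τ.1, fun i j => ?_⟩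
  rw [Fin.lt_def, Fin.lt_def]
  have h := fun i : Fin σ.1 => permSum_apply_left σ τ i i.2 (by rw [permSum_fst]; omega)
  exact iff_of_eq (congrArg₂ _ (h i) (h j))

theorem contains_permSum_right (σ τ : FinPerm) : Contains (permSum σ τ) τ := by
  refine ⟨Fin.natAddOrderEmb σ.1, fun i j => ?_⟩
  rw [Fin.lt_def, Fin.lt_def]
  have h := fun i : Fin τ.1 => permSum_apply_right σ τ i i.2 (by rw [permSum_fst]; omega)
  exact (iff_of_eq (congrArg₂ _ (h i) (h j))).trans (by simp)

/-- The first `t` values of `π` are the `t` smallest ones. -/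
def IsCut (π : FinPerm) (t : ℕ) : Prop :=
  ∀ (i : ℕ) (hi : i < π.1), i < t → (π.2 ⟨i, hi⟩ : ℕ) < t

/-- By injectivity and finiteness `π` permutes the positions below `t`, so no later position can
take a value there. -/
theorem IsCut.le_apply {π : FinPerm} {t : ℕ} (h : IsCut π t) (i : Fin π.1)
    (hi : t ≤ i) : t ≤ π.2 i := by
  let s : Finset (Fin π.1) := Finset.univ.filter fun i => (i : ℕ) < t
  have hmap : s.image π.2 = s := by
    refine Finset.eq_of_subset_of_card_le ?_ ?_
    · intro x hx
      obtain ⟨y, hy, rfl⟩ := Finset.mem_image.1 hx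
      simp only [s, Finset.mem_filter, Finset.mem_univ, true_and] at hy ⊢
      exact h y y.2 hy
    · rw [Finset.card_image_of_injective _ π.2.injective]
  by_contra hlt
  have hmem : π.2 i ∈ s.image π.2 := by
    rw [hmap]
    simpa [s] using hlt
  obtain ⟨y, hy, hyi⟩ := Finset.mem_image.1 hmem
  have := π.2.injective hyi
  subst this
  simp only [s, Finset.mem_filter, Finset.mem_univ, true_and] at hy
  omega

theorem IsCut.exists_eq_permSum {π : FinPerm} {t : ℕ} (h : IsCut π t) (ht : t ≤ π.1) :
    ∃ σ τ : FinPerm, σ.1 = t ∧ π = permSum σ τ := by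
  let f : Fin t → Fin t := fun i => ⟨π.2 ⟨i, by omega⟩, h i (by omega) i.2⟩
  have hf : Function.Injective f := by
    intro a b hab
    have h1 : (π.2 ⟨a, by omega⟩ : ℕ) = π.2 ⟨b, by omega⟩ :=
      congrArg (fun x : Fin t => (x : ℕ)) hab
    have h2 := π.2.injective (Fin.ext h1)
    simpa [Fin.ext_iff] using h2
  let g : Fin (π.1 - t) → Fin (π.1 - t) := fun i => ⟨π.2 ⟨t + i, by omega⟩ - t, by
    have := (π.2 ⟨t + i, by omega⟩).2
    have := h.le_apply ⟨t + i, by omega⟩ (by simp)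
    omega⟩
  have hg : Function.Injective g := by
    intro a b hab
    have h1 : (π.2 ⟨t + a, by omega⟩ : ℕ) - t = π.2 ⟨t + b, by omega⟩ - t :=
      congrArg (fun x : Fin (π.1 - t) => (x : ℕ)) hab
    have ha := h.le_apply ⟨t + a, by omega⟩ (by simp)
    have hb := h.le_apply ⟨t + b, by omega⟩ (by simp)
    have h3 : (π.2 ⟨t + a, by omega⟩ : ℕ) = π.2 ⟨t + b, by omega⟩ := by omega
    have h2 := π.2.injective (Fin.ext h3)
    simpa [Fin.ext_iff] using h2
  refine ⟨⟨t, Equiv.ofBijective f (Finite.injective_iff_bijective.1 hf)⟩,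
    ⟨π.1 - t, Equiv.ofBijective g (Finite.injective_iff_bijective.1 hg)⟩, rfl, ?_⟩
  refine FinPerm.ext_nat (by rw [permSum_fst]; simp only; omega) fun i hi hi' => ?_
  rcases lt_or_ge i t with hit | hit
  · rw [permSum_apply_left _ _ _ hit]
    rfl
  · obtain ⟨c, rfl⟩ := Nat.exists_eq_add_of_le hit
    rw [permSum_apply_right _ _ _ (by simp only; omega)]
    have := h.le_apply ⟨t + c, by omega⟩ (by simp)
    simp only [Equiv.ofBijective_apply, g]
    omega

theorem isCut_permSum (σ τ : FinPerm) : IsCut (permSum σ τ) σ.1 := by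
  intro i hi hit
  rw [permSum_apply_left σ τ i hit]
  exact (σ.2 _).2

theorem isCut_permSum_iff {σ : FinPerm} (τ : FinPerm) {t : ℕ} (ht : t ≤ σ.1) :
    IsCut (permSum σ τ) t ↔ IsCut σ t := by
  refine ⟨fun h i hi hit => ?_, fun h i hi hit => ?_⟩
  · have := h i (by rw [permSum_fst]; omega) hit
    rwa [permSum_apply_left σ τ i hi] at this
  · rw [permSum_apply_left σ τ i (by omega)]
    exact h _ _ hit

theorem Indecomposable.not_isCut {π : FinPerm} (h : Indecomposable π) {t : ℕ} (h0 : 0 < t)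
    (ht : t < π.1) : ¬ IsCut π t := by
  intro hc
  obtain ⟨σ, τ, hσ, rfl⟩ := hc.exists_eq_permSum ht.le
  rw [permSum_fst] at ht
  exact h.2 ⟨σ, τ, by omega, by omega, rfl⟩

theorem permSum_left_cancel {σ σ' τ τ' : FinPerm} (hs : σ.1 = σ'.1)
    (h : permSum σ τ = permSum σ' τ') : σ = σ' ∧ τ = τ' := by
  have hsize := congrArg Sigma.fst h
  rw [permSum_fst, permSum_fst] at hsize
  have happ : ∀ (i : ℕ) (hi : i < (permSum σ τ).1) (hi' : i < (permSum σ' τ').1),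
      ((permSum σ τ).2 ⟨i, hi⟩ : ℕ) = (permSum σ' τ').2 ⟨i, hi'⟩ := by
    rw [h]
    intros
    rfl
  constructor
  · refine FinPerm.ext_nat hs fun i hi hi' => ?_
    rw [← permSum_apply_left σ τ i hi (by rw [permSum_fst]; omega),
      ← permSum_apply_left σ' τ' i hi' (by rw [permSum_fst]; omega), happ]
  · refine FinPerm.ext_nat (by omega) fun i hi hi' => ?_
    have h1 := permSum_apply_right σ τ i hi (by rw [permSum_fst]; omega)
    have h2 := permSum_apply_right σ' τ' i hi' (by rw [permSum_fst]; omega)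
    have h3 := happ (σ.1 + i) (by rw [permSum_fst]; omega) (by rw [permSum_fst]; omega)
    simp only [hs] at h1 h3
    omega

/-- If the first summands had different sizes, the shorter one would give a cut inside the longer
one. -/
theorem Indecomposable.permSum_inj {σ σ' τ τ' : FinPerm} (hσ : Indecomposable σ)
    (hσ' : Indecomposable σ') (h : permSum σ τ = permSum σ' τ') : σ = σ' ∧ τ = τ' := by
  refine permSum_left_cancel ?_ h
  rcases lt_trichotomy σ.1 σ'.1 with hlt | heq | hlt
  · exact absurd ((isCut_permSum_iff τ' hlt.le).1 (h ▸ isCut_permSum σ τ)) (hσ'.not_isCut hσ.1 hlt)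
  · exact heq
  · exact absurd ((isCut_permSum_iff τ hlt.le).1 (h ▸ isCut_permSum σ' τ'))
      (hσ.not_isCut hσ'.1 hlt)

/-- Cut at the least positive cut: splitting the resulting summand further would produce a smaller
one. -/
theorem exists_indecomposable_permSum (π : FinPerm) (hπ : 0 < π.1) :
    ∃ σ τ : FinPerm, Indecomposable σ ∧ π = permSum σ τ := by
  classical
  have hex : ∃ t, 0 < t ∧ IsCut π t := ⟨π.1, hπ, fun i hi _ => (π.2 _).2⟩
  have hle : Nat.find hex ≤ π.1 := Nat.find_min' hex ⟨hπ, fun i hi _ => (π.2 _).2⟩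
  obtain ⟨h0, hc⟩ := Nat.find_spec hex
  obtain ⟨σ, τ, hσ, hπ'⟩ := hc.exists_eq_permSum hle
  refine ⟨σ, τ, ⟨by omega, ?_⟩, hπ'⟩
  rintro ⟨β, γ, hβ, hγ, rfl⟩
  rw [permSum_fst] at hσ
  refine Nat.find_min hex (m := β.1) (by omega) ⟨hβ, ?_⟩
  rw [hπ', isCut_permSum_iff _ (by rw [permSum_fst]; omega)]
  exact isCut_permSum β γ

/-! ### The recurrence for the class. -/

theorem count_eq_ncard (C : Set FinPerm) (n : ℕ) : count C n = Set.ncard {π ∈ C | π.1 = n} := by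
  have : {π ∈ C | π.1 = n} =
      (fun π : Equiv.Perm (Fin n) => (⟨n, π⟩ : FinPerm)) '' {π | (⟨n, π⟩ : FinPerm) ∈ C} := by
    ext π
    constructor
    · rintro ⟨hπ, rfl⟩
      exact ⟨π.2, hπ, rfl⟩
    · rintro ⟨τ, hτ, rfl⟩
      exact ⟨hτ, rfl⟩
  have hinj : Function.Injective fun π : Equiv.Perm (Fin n) => (⟨n, π⟩ : FinPerm) :=
    fun a b h => by simpa using h
  rw [this, Set.ncard_image_of_injective _ hinj]
  rfl

theorem finite_setOf_size_eq (C : Set FinPerm) (n : ℕ) : {π ∈ C | π.1 = n}.Finite := by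
  refine (Set.finite_range fun π : Equiv.Perm (Fin n) => (⟨n, π⟩ : FinPerm)).subset ?_
  rintro π ⟨-, rfl⟩
  exact ⟨π.2, rfl⟩

/-- The type `S` is general so that the first component can be an indecomposable, or an
indecomposable with a marked offset. -/
theorem ncard_setOf_add_eq {S : Type*} (A : Set S) (B : Set FinPerm) (size : S → ℕ) (w : ℕ → ℕ)
    (hfin : ∀ k, {a ∈ A | size a = k}.Finite)
    (hw : ∀ k, {a ∈ A | size a = k}.ncard = w k) (n : ℕ) :
    {x : S × FinPerm | x.1 ∈ A ∧ x.2 ∈ B ∧ size x.1 + x.2.1 = n}.ncard =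
      ∑ kl ∈ Finset.HasAntidiagonal.antidiagonal n, w kl.1 * count B kl.2 := by
  classical
  have hset : {x : S × FinPerm | x.1 ∈ A ∧ x.2 ∈ B ∧ size x.1 + x.2.1 = n} =
      ((Finset.HasAntidiagonal.antidiagonal n).biUnion fun kl => (hfin kl.1).toFinset ×ˢ
        (finite_setOf_size_eq B kl.2).toFinset : Finset (S × FinPerm)) := by
    ext ⟨a, b⟩
    simp only [Set.mem_ofPred_eq, Finset.coe_biUnion, Finset.mem_coe, Finset.HasAntidiagonal.mem_antidiagonal,
      Set.mem_iUnion, Finset.mem_product, Set.Finite.mem_toFinset, Prod.exists]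
    constructor
    · rintro ⟨ha, hb, h⟩
      exact ⟨_, _, h, ⟨ha, rfl⟩, hb, rfl⟩
    · rintro ⟨k, l, h, ⟨ha, rfl⟩, hb, rfl⟩
      exact ⟨ha, hb, h⟩
  rw [hset, Set.ncard_coe_finset, Finset.card_biUnion]
  · refine Finset.sum_congr rfl fun kl _ => ?_
    rw [Finset.card_product, ← Set.ncard_eq_toFinset_card _ (hfin _),
      ← Set.ncard_eq_toFinset_card _ (finite_setOf_size_eq _ _), hw,
      count_eq_ncard]
  · rintro ⟨k, l⟩ _ ⟨k', l'⟩ _ hne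
    rw [Function.onFun, Finset.disjoint_left]
    rintro ⟨a, b⟩ h1 h2
    simp only [Finset.mem_product, Set.Finite.mem_toFinset, Set.mem_ofPred_eq] at h1 h2
    exact hne (Prod.ext (h1.1.2.symm.trans h2.1.2) (h1.2.2.symm.trans h2.2.2))

theorem count_eq_sum_indec {C : Set FinPerm} (hC : IsPermClass C) (hsum : SumClosed C) {n : ℕ}
    (hn : 0 < n) :
    count C n = ∑ kl ∈ Finset.HasAntidiagonal.antidiagonal n, count (indec C) kl.1 * count C kl.2 := by
  rw [← ncard_setOf_add_eq (indec C) C Sigma.fst _ (finite_setOf_size_eq _)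
    (fun k => (count_eq_ncard _ k).symm), count_eq_ncard]
  have himage : {π ∈ C | π.1 = n} = (fun x : FinPerm × FinPerm => permSum x.1 x.2) ''
      {x | x.1 ∈ indec C ∧ x.2 ∈ C ∧ x.1.1 + x.2.1 = n} := by
    ext π
    constructor
    · rintro ⟨hπ, rfl⟩
      obtain ⟨σ, τ, hσ, rfl⟩ := exists_indecomposable_permSum π hn
      exact ⟨(σ, τ), ⟨⟨hC _ hπ _ (contains_permSum_left σ τ), hσ⟩,
        hC _ hπ _ (contains_permSum_right σ τ), rfl⟩, rfl⟩
    · rintro ⟨⟨σ, τ⟩, ⟨hσ, hτ, h⟩, rfl⟩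
      exact ⟨hsum _ hσ.1 _ hτ, h⟩
  rw [himage, Set.InjOn.ncard_image]
  rintro ⟨σ, τ⟩ h ⟨σ', τ'⟩ h' heq
  obtain ⟨h1, h2⟩ := h.1.2.permSum_inj h'.1.2 heq
  exact Prod.ext h1 h2

theorem count_indec_zero (C : Set FinPerm) : count (indec C) 0 = 0 := by
  rw [count_eq_ncard]
  convert Set.ncard_empty FinPerm
  ext π
  simp only [indec, Indecomposable, Set.mem_ofPred_eq, Set.mem_empty_iff_false, iff_false]
  rintro ⟨⟨_, h, _⟩, h0⟩
  omega

theorem count_zero {C : Set FinPerm} (hC : IsPermClass C) (hne : C.Nonempty) : count C 0 = 1 := by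
  obtain ⟨π, hπ⟩ := hne
  have hmem : ∀ e : Equiv.Perm (Fin 0), (⟨0, e⟩ : FinPerm) ∈ C := fun e =>
    hC π hπ _ ⟨⟨⟨Fin.elim0, fun a => a.elim0⟩, fun {a} => a.elim0⟩, fun i => i.elim0⟩
  unfold count
  simp [hmem]

/-! ### Shifted infinite sums and the recurrence for affine permutations. -/

/-- The function `Σ^r (⊕ π)` on `ℤ`, defined to be the identity if `π` is empty. -/
noncomputable def shiftedSum (π : FinPerm) (r : ℤ) : ℤ → ℤ :=
  if h : π.1 = 0 then id else
    haveI : NeZero π.1 := ⟨h⟩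
    (AffinePerm.shift r (infSum π.2)).toPerm

theorem shiftedSum_apply (π : FinPerm) (r : ℤ) (i : ℕ) (hi : i < π.1) (k : ℤ) :
    shiftedSum π r (r + 1 + i + k * π.1) = r + 1 + (π.2 ⟨i, hi⟩ : ℕ) + k * π.1 := by
  have h : π.1 ≠ 0 := by omega
  have : NeZero π.1 := ⟨h⟩
  rw [shiftedSum, dif_neg h]
  have h1 := infSumPerm_apply π.2 ⟨i, hi⟩ k
  have h2 : r + 1 + (i : ℤ) + k * π.1 - r = (i : ℤ) + 1 + k * π.1 := by ring
  simp only [AffinePerm.shift, infSum, Equiv.trans_apply, Equiv.subRight_apply,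
    Equiv.coe_addRight, h2]
  simp only at h1
  rw [h1]
  ring

theorem exists_eq_shift_add (n : ℕ) (hn : 0 < n) (r j : ℤ) :
    ∃ i : ℕ, i < n ∧ ∃ k : ℤ, j = r + 1 + i + k * n := by
  have : NeZero n := ⟨hn.ne'⟩
  obtain ⟨i, k, h⟩ := exists_eq_add_mul (n := n) (j - r)
  exact ⟨i, i.2, k, by linarith⟩

theorem eq_shiftedSum (π : FinPerm) (hπ : 0 < π.1) (r : ℤ) (f : ℤ → ℤ)
    (h : ∀ (i : ℕ) (hi : i < π.1) (k : ℤ),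
      f (r + 1 + i + k * π.1) = r + 1 + (π.2 ⟨i, hi⟩ : ℕ) + k * π.1) : f = shiftedSum π r := by
  funext j
  obtain ⟨i, hi, k, rfl⟩ := exists_eq_shift_add π.1 hπ r j
  rw [h i hi, shiftedSum_apply]

theorem shiftedSum_injective {π τ : FinPerm} (h : π.1 = τ.1) {r : ℤ}
    (hf : shiftedSum π r = shiftedSum τ r) : π = τ := by
  refine FinPerm.ext_nat h fun i hi hi' => ?_
  have h1 := shiftedSum_apply π r i hi 0
  have h2 := shiftedSum_apply τ r i hi' 0
  rw [hf] at h1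
  simp only [zero_mul, add_zero] at h1 h2
  omega

theorem shiftedSum_add_mul (π : FinPerm) (r m : ℤ) :
    shiftedSum π (r + m * π.1) = shiftedSum π r := by
  rcases Nat.eq_zero_or_pos π.1 with h0 | hπ
  · simp [h0]
  symm
  refine eq_shiftedSum π hπ _ _ fun i hi k => ?_
  have h := shiftedSum_apply π r i hi (k + m)
  rw [show r + 1 + (i : ℤ) + (k + m) * π.1 = r + m * π.1 + 1 + i + k * π.1 by ring] at h
  rw [h]
  ring

/-- The infinite sum repeats `σ τ σ τ ...`; starting the period one block later reads `τ σ`. -/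
theorem shiftedSum_permSum_comm (σ τ : FinPerm) (r : ℤ) :
    shiftedSum (permSum σ τ) r = shiftedSum (permSum τ σ) (r + σ.1) := by
  rcases Nat.eq_zero_or_pos (σ.1 + τ.1) with h0 | hpos
  · rw [shiftedSum, dif_pos (by rw [permSum_fst]; omega), shiftedSum,
      dif_pos (by rw [permSum_fst]; omega)]
  refine eq_shiftedSum _ (by rw [permSum_fst]; omega) _ _ fun i hi k => ?_
  rcases lt_or_ge i τ.1 with hit | hit
  · have h := shiftedSum_apply (permSum σ τ) r (σ.1 + i) (by rw [permSum_fst]; omega) k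
    rw [permSum_apply_right _ _ i hit] at h
    rw [permSum_apply_left _ _ i hit]
    simp only [permSum_fst] at h ⊢
    push_cast at h ⊢
    convert h using 1
    · congr 1
      ring
    · ring
  · obtain ⟨c, rfl⟩ := Nat.exists_eq_add_of_le hit
    have hc : c < σ.1 := by rw [permSum_fst] at hi; omega
    -- In the rotated period the copy of `σ` comes after `τ`, so it belongs to the next original
    -- period.
    have h := shiftedSum_apply (permSum σ τ) r c (by rw [permSum_fst]; omega) (k + 1)
    rw [permSum_apply_left _ _ c hc] at h
    rw [permSum_apply_right _ _ c hc]
    simp only [permSum_fst] at h ⊢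
    push_cast at h ⊢
    convert h using 1
    · congr 1
      ring
    · ring

/-- The function `f` preserves `{i | i ≤ t}`, forwards and backwards. -/
def IsIntCut (f : ℤ → ℤ) (t : ℤ) : Prop := ∀ i, i ≤ t ↔ f i ≤ t

theorem isIntCut_shiftedSum {π : FinPerm} (hπ : 0 < π.1) (r : ℤ) :
    IsIntCut (shiftedSum π r) r := by
  have key : ∀ (c : ℕ) (k : ℤ), c < π.1 → (r + 1 + c + k * π.1 ≤ r ↔ k < 0) := by
    intro c k hc
    have hc' : (c : ℤ) < π.1 := by exact_mod_cast hc
    constructor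
    · intro h
      by_contra! hk
      nlinarith
    · intro h
      nlinarith
  intro j
  obtain ⟨i, hi, k, rfl⟩ := exists_eq_shift_add π.1 hπ r j
  rw [shiftedSum_apply _ _ _ hi, key i k hi, key _ k (π.2 _).2]

theorem isCut_of_isIntCut {π : FinPerm} {r : ℤ} {s : ℕ}
    (h : IsIntCut (shiftedSum π r) (r + s)) : IsCut π s := by
  intro i hi his
  have h1 := shiftedSum_apply π r i hi 0
  have h2 := (h (r + 1 + i + 0 * π.1)).1 (by omega)
  rw [h1] at h2
  omega

theorem Indecomposable.not_isIntCut {σ : FinPerm} (hσ : Indecomposable σ) (τ : FinPerm)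
    {r t : ℤ} (h0 : r < t) (ht : t < r + σ.1) : ¬ IsIntCut (shiftedSum (permSum σ τ) r) t := by
  intro h
  obtain ⟨s, rfl⟩ : ∃ s : ℕ, t = r + s := ⟨(t - r).toNat, by omega⟩
  exact hσ.not_isCut (t := s) (by omega) (by omega)
    ((isCut_permSum_iff τ (by omega)).1 (isCut_of_isIntCut h))

/-- Counting functions on `ℤ` avoids a type depending on `n`, so permutations of propositionally
equal sizes can be compared. -/
theorem affCount_eq_ncard (C : Set FinPerm) {n : ℕ} (hn : 0 < n) :
    affCount C n = Set.ncard {f | ∃ π ∈ C, π.1 = n ∧ ∃ r, f = shiftedSum π r} := by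
  obtain ⟨n, rfl⟩ := Nat.exists_eq_succ_of_ne_zero hn.ne'
  have himage : {f | ∃ π ∈ C, π.1 = n + 1 ∧ ∃ r, f = shiftedSum π r} =
      (fun ω : AffinePerm (n + 1) => (ω.toPerm : ℤ → ℤ)) '' infSumClass C (n + 1) := by
    ext f
    constructor
    · rintro ⟨⟨m, π⟩, hπ, rfl, r, rfl⟩
      exact ⟨_, ⟨π, hπ, r, rfl⟩, by rw [shiftedSum, dif_neg (Nat.succ_ne_zero n)]⟩
    · rintro ⟨_, ⟨π, hπ, r, rfl⟩, rfl⟩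
      exact ⟨_, hπ, rfl, r, by rw [shiftedSum, dif_neg (Nat.succ_ne_zero n)]⟩
  have hinj : Function.Injective fun ω : AffinePerm (n + 1) => (ω.toPerm : ℤ → ℤ) :=
    fun a b h => AffinePerm.ext (DFunLike.coe_injective h)
  rw [Nat.succ_eq_add_one, himage, Set.ncard_image_of_injective _ hinj]
  rfl

/-- If the first block ends at or before position 0, rotating it to the end moves the start of the
period right by its size; iterate until the first block covers position 1. -/
theorem exists_shiftedSum_indec {C : Set FinPerm} (hC : IsPermClass C) (hsum : SumClosed C)
    (m : ℕ) {π : FinPerm} (hπ : π ∈ C) (hpos : 0 < π.1) :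
    ∃ (σ τ : FinPerm) (j : ℕ), σ ∈ indec C ∧ τ ∈ C ∧ j < σ.1 ∧ σ.1 + τ.1 = π.1 ∧
      shiftedSum π (-m) = shiftedSum (permSum σ τ) (-j) := by
  induction m using Nat.strong_induction_on generalizing π with
  | _ m ih =>
    obtain ⟨σ, τ, hσ, rfl⟩ := exists_indecomposable_permSum π hpos
    have hσC := hC _ hπ _ (contains_permSum_left σ τ)
    have hτC := hC _ hπ _ (contains_permSum_right σ τ)
    rcases lt_or_ge m σ.1 with hlt | hge
    · exact ⟨σ, τ, m, ⟨hσC, hσ⟩, hτC, hlt, rfl, rfl⟩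
    · have h0 := hσ.1
      obtain ⟨σ', τ', j, h1, h2, h3, h4, h5⟩ := ih (m - σ.1) (by omega) (hsum _ hτC _ hσC)
        (by rw [permSum_fst]; omega)
      refine ⟨σ', τ', j, h1, h2, h3, by rw [h4, permSum_fst, permSum_fst, add_comm], ?_⟩
      rw [shiftedSum_permSum_comm, ← h5]
      congr 1
      omega

theorem affCount_eq_sum_indec {C : Set FinPerm} (hC : IsPermClass C) (hsum : SumClosed C) {n : ℕ}
    (hn : 0 < n) :
    affCount C n = ∑ kl ∈ Finset.HasAntidiagonal.antidiagonal n,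
      kl.1 * count (indec C) kl.1 * count C kl.2 := by
  let A : Set (FinPerm × ℕ) := {x | x.1 ∈ indec C ∧ x.2 < x.1.1}
  have hA : ∀ k, {a ∈ A | a.1.1 = k} = {π ∈ indec C | π.1 = k} ×ˢ Set.Iio k := by
    intro k
    ext ⟨π, j⟩
    simp only [A, Set.mem_prod, Set.mem_ofPred_eq, Set.mem_Iio]
    constructor
    · rintro ⟨⟨h1, h2⟩, rfl⟩
      exact ⟨⟨h1, rfl⟩, h2⟩
    · rintro ⟨⟨h1, rfl⟩, h2⟩
      exact ⟨⟨h1, h2⟩, rfl⟩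
  rw [← ncard_setOf_add_eq A C (fun a => a.1.1) (fun k => k * count (indec C) k) (fun k => by
      rw [hA]
      exact (finite_setOf_size_eq _ k).prod (Set.finite_Iio k)) (fun k => by
      rw [hA, Set.ncard_prod, ← count_eq_ncard, mul_comm]
      simp [Set.ncard_eq_toFinset_card']), affCount_eq_ncard C hn]
  have himage : {f | ∃ π ∈ C, π.1 = n ∧ ∃ r, f = shiftedSum π r} =
      (fun x : (FinPerm × ℕ) × FinPerm => shiftedSum (permSum x.1.1 x.2) (-x.1.2)) ''
        {x | x.1 ∈ A ∧ x.2 ∈ C ∧ x.1.1.1 + x.2.1 = n} := by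
    ext f
    constructor
    · rintro ⟨π, hπ, rfl, r, rfl⟩
      -- Only `r` modulo the size matters; subtracting `|r|` periods makes the shift nonpositive.
      have hr : shiftedSum π r = shiftedSum π (-((r.natAbs * π.1 - r).toNat : ℕ)) := by
        rw [← shiftedSum_add_mul π r (-r.natAbs), Int.toNat_of_nonneg]
        · congr 1
          ring
        · have h1 : (1 : ℤ) ≤ π.1 := by exact_mod_cast hn
          have h2 : (0 : ℤ) ≤ r.natAbs := by positivity
          have h3 : r ≤ r.natAbs := Int.le_natAbs
          nlinarith
      obtain ⟨σ, τ, j, h1, h2, h3, h4, h5⟩ := exists_shiftedSum_indec hC hsum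
        ((r.natAbs * π.1 - r).toNat) hπ hn
      exact ⟨((σ, j), τ), ⟨⟨h1, h3⟩, h2, h4⟩, by rw [hr, h5]⟩
    · rintro ⟨⟨⟨σ, j⟩, τ⟩, ⟨⟨h1, h2⟩, h3, h4⟩, rfl⟩
      exact ⟨_, hsum _ h1.1 _ h3, h4, _, rfl⟩
  rw [himage, Set.InjOn.ncard_image]
  rintro ⟨⟨σ, j⟩, τ⟩ ⟨⟨h1, h2⟩, h3, h4⟩ ⟨⟨σ', j'⟩, τ'⟩ ⟨⟨h1', h2'⟩, h3', h4'⟩ heq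
  simp only at h1 h2 h3 h4 h1' h2' h3' h4' heq
  have hcut := isIntCut_shiftedSum (π := permSum σ τ) (by rw [permSum_fst]; omega) (-j)
  have hcut' := isIntCut_shiftedSum (π := permSum σ' τ') (by rw [permSum_fst]; omega) (-j')
  -- If `j < j'`, the cut at `-j` falls strictly inside the block of `σ'`, which begins after `-j'`
  -- and ends beyond 0.
  obtain rfl : j = j' := by
    rcases lt_trichotomy j j' with hlt | h | hlt
    · exact absurd (heq ▸ hcut) (h1'.2.not_isIntCut τ' (by omega) (by omega))
    · exact h
    · exact absurd (heq ▸ hcut') (h1.2.not_isIntCut τ (by omega) (by omega))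
  obtain ⟨rfl, rfl⟩ := h1.2.permSum_inj h1'.2
    (shiftedSum_injective (by rw [permSum_fst, permSum_fst, h4, h4']) heq)
  rfl

/-! ### Power series and the renewal theorem. -/

theorem mul_pow_pred_mul_sub_le {s t : ℝ} (ht : 0 ≤ t) (hts : t ≤ s) (k : ℕ) :
    k * t ^ (k - 1) * (s - t) ≤ s ^ k - t ^ k := by
  induction k with
  | zero => simp
  | succ k ih =>
    have h1 : 0 ≤ (s - t) * (s ^ k - t ^ k) :=
      mul_nonneg (sub_nonneg.2 hts) (sub_nonneg.2 (pow_le_pow_left₀ ht hts k))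
    have h2 : (k : ℝ) * t ^ k = t * (k * t ^ (k - 1)) := by
      rcases k with _ | k
      · simp
      · simp [pow_succ]
        ring
    have h3 := mul_le_mul_of_nonneg_left ih ht
    push_cast [Nat.add_sub_cancel]
    have h4 : ((k : ℝ) + 1) * t ^ k * (s - t) =
      t * (k * t ^ (k - 1) * (s - t)) + t ^ k * (s - t) := by
      rw [add_mul, h2]
      ring
    rw [h4, pow_succ, pow_succ]
    linarith

theorem summable_mul_nat_mul_pow {a : ℕ → ℝ} (ha : ∀ k, 0 ≤ a k) {s t : ℝ} (ht : 0 ≤ t)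
    (hts : t < s) (hs : Summable fun k => a k * s ^ k) :
    Summable fun k : ℕ => a k * (k * t ^ (k - 1)) := by
  refine Summable.of_nonneg_of_le (fun k => mul_nonneg (ha k) (by positivity)) (fun k => ?_)
    (hs.mul_right (s - t)⁻¹)
  rw [mul_assoc]
  refine mul_le_mul_of_nonneg_left ?_ (ha k)
  rw [← div_eq_mul_inv, le_div_iff₀ (sub_pos.2 hts)]
  exact (mul_pow_pred_mul_sub_le ht hts.le k).trans (by linarith [pow_nonneg ht k])

theorem hasDerivAt_tsum_mul_pow {𝕜 : Type*} [RCLike 𝕜] {a : ℕ → 𝕜} {s : ℝ}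
    (hs : Summable fun k => ‖a k‖ * s ^ k) {z : 𝕜} (hz : ‖z‖ < s) :
    HasDerivAt (fun w => ∑' k, a k * w ^ k) (∑' k : ℕ, a k * (k * z ^ (k - 1))) z := by
  obtain ⟨t, hzt, hts⟩ := exists_between hz
  have ht : 0 ≤ t := (norm_nonneg z).trans hzt.le
  refine hasDerivAt_tsum_of_isPreconnected (t := Metric.ball 0 t) (y₀ := 0)
    (summable_mul_nat_mul_pow (fun k => norm_nonneg (a k)) ht hts hs) Metric.isOpen_ball
    (convex_ball 0 t).isPreconnected (fun k y _ => (hasDerivAt_pow k y).const_mul (a k))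
    (fun k y hy => ?_) ?_ ?_ ?_
  · rw [norm_mul, norm_mul, norm_pow, RCLike.norm_natCast]
    have : ‖y‖ ≤ t := by simpa using (mem_ball_zero_iff.1 hy).le
    gcongr
  · simpa using (norm_nonneg z).trans_lt hzt
  · refine summable_of_ne_finset_zero (s := {0}) fun k hk => ?_
    simp only [Finset.mem_singleton] at hk
    simp [hk]
  · simpa using hzt

/-- Real parts give `∑ p k * (1 - Re (z ^ k)) = 0` with nonnegative terms, so `z ^ k = 1` on the
support of `p`. The order of `z` divides the whole support, and aperiodicity makes it 1. -/
theorem eq_one_of_tsum_mul_pow_eq_one {p : ℕ → ℝ} (hp : ∀ k, 0 ≤ p k) (h0 : p 0 = 0)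
    (hp1 : HasSum p 1) (haper : ∀ d, 2 ≤ d → ∃ k, p k ≠ 0 ∧ ¬ d ∣ k) {z : ℂ} (hz : ‖z‖ ≤ 1)
    (h : HasSum (fun k => (p k : ℂ) * z ^ k) 1) : z = 1 := by
  have hnorm : ∀ k, ‖z ^ k‖ ≤ 1 := fun k => by
    rw [norm_pow]
    exact pow_le_one₀ (norm_nonneg z) hz
  have hre : HasSum (fun k => p k * (1 - (z ^ k).re)) 0 := by
    have h1 := Complex.hasSum_re h
    simp only [Complex.re_ofReal_mul, Complex.one_re] at h1
    simpa [mul_sub] using hp1.sub h1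
  have hnn : ∀ k, 0 ≤ p k * (1 - (z ^ k).re) := fun k =>
    mul_nonneg (hp k) (sub_nonneg.2 ((Complex.re_le_norm _).trans (hnorm k)))
  have hpow : ∀ k, p k ≠ 0 → z ^ k = 1 := by
    intro k hk
    have h1 := congrFun ((hasSum_zero_iff_of_nonneg hnn).1 hre) k
    have h2 : (z ^ k).re = 1 := by
      rcases mul_eq_zero.1 h1 with h1 | h1
      · exact absurd h1 hk
      · linarith
    have h3 : Complex.normSq (z ^ k) ≤ 1 := by
      rw [Complex.normSq_eq_norm_sq]
      exact pow_le_one₀ (norm_nonneg _) (hnorm k)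
    rw [Complex.normSq_apply, h2] at h3
    refine Complex.ext h2 ?_
    rw [Complex.one_im]
    nlinarith
  have hex : ∃ k, p k ≠ 0 := by
    by_contra! hall
    have : HasSum p 0 := by
      convert hasSum_zero using 1
      exact funext hall
    exact one_ne_zero (hp1.unique this)
  obtain ⟨k, hk⟩ := hex
  have hk0 : k ≠ 0 := by
    rintro rfl
    exact hk h0
  have hord : orderOf z ≠ 0 := by
    intro h0
    have := orderOf_dvd_of_pow_eq_one (hpow k hk)
    rw [h0, zero_dvd_iff] at this
    exact hk0 this
  by_contra hz1
  have hord1 : orderOf z ≠ 1 := fun h1 => hz1 (orderOf_eq_one_iff.1 h1)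
  obtain ⟨l, hl, hdvd⟩ := haper (orderOf z) (by omega)
  exact hdvd (orderOf_dvd_of_pow_eq_one (hpow l hl))

/-- The renewal sequence of a probability distribution is bounded by `1`. -/
theorem renewal_mem_Icc {p u : ℕ → ℝ} (hp : ∀ k, 0 ≤ p k) (h0 : p 0 = 0) (hp1 : HasSum p 1)
    (hu0 : u 0 = 1) (hu : ∀ n, 0 < n →
      u n = ∑ kl ∈ Finset.HasAntidiagonal.antidiagonal n, p kl.1 * u kl.2) (n : ℕ) :
    0 ≤ u n ∧ u n ≤ 1 := by
  induction n using Nat.strong_induction_on with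
  | _ n ih =>
    rcases Nat.eq_zero_or_pos n with rfl | hn
    · simp [hu0]
    have hle : ∀ kl ∈ Finset.HasAntidiagonal.antidiagonal n,
        0 ≤ p kl.1 * u kl.2 ∧ p kl.1 * u kl.2 ≤ p kl.1 := by
      intro kl hkl
      rw [Finset.HasAntidiagonal.mem_antidiagonal] at hkl
      rcases Nat.eq_zero_or_pos kl.1 with hk | hk
      · simp [hk, h0]
      · obtain ⟨h1, h2⟩ := ih kl.2 (by omega)
        exact ⟨mul_nonneg (hp _) h1, mul_le_of_le_one_right (hp _) h2⟩
    rw [hu n hn]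
    refine ⟨Finset.sum_nonneg fun kl h => (hle kl h).1,
      (Finset.sum_le_sum fun kl h => (hle kl h).2).trans ?_⟩
    rw [Finset.Nat.sum_antidiagonal_eq_sum_range_succ_mk]
    exact sum_le_hasSum _ (fun k _ => hp k) hp1

theorem renewal_mul_one_sub {p u : ℕ → ℝ} (hp : ∀ k, 0 ≤ p k) (h0 : p 0 = 0) (hp1 : HasSum p 1)
    (hu0 : u 0 = 1) (hu : ∀ n, 0 < n →
      u n = ∑ kl ∈ Finset.HasAntidiagonal.antidiagonal n, p kl.1 * u kl.2) {z : ℂ}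
    (hz : ‖z‖ < 1) : Summable (fun n => (u n : ℂ) * z ^ n) ∧
      (∑' n, (u n : ℂ) * z ^ n) * (1 - ∑' k, (p k : ℂ) * z ^ k) = 1 := by
  have hub := renewal_mem_Icc hp h0 hp1 hu0 hu
  have hgeo := summable_geometric_of_lt_one (norm_nonneg z) hz
  have hU : Summable fun n => ‖(u n : ℂ) * z ^ n‖ := by
    refine Summable.of_nonneg_of_le (fun n => norm_nonneg _) (fun n => ?_) hgeo
    rw [norm_mul, norm_pow, Complex.norm_real, Real.norm_of_nonneg (hub n).1]
    exact mul_le_of_le_one_left (by positivity) (hub n).2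
  have hP : Summable fun k => ‖(p k : ℂ) * z ^ k‖ := by
    refine Summable.of_nonneg_of_le (fun n => norm_nonneg _) (fun k => ?_) hp1.summable
    rw [norm_mul, norm_pow, Complex.norm_real, Real.norm_of_nonneg (hp k)]
    exact mul_le_of_le_one_right (hp k) (pow_le_one₀ (norm_nonneg z) hz.le)
  refine ⟨hU.of_norm, ?_⟩
  have hprod := tsum_mul_tsum_eq_tsum_sum_antidiagonal_of_summable_norm hP hU
  have hcoef : ∀ n, ∑ kl ∈ Finset.HasAntidiagonal.antidiagonal n,
      (p kl.1 : ℂ) * z ^ kl.1 * ((u kl.2 : ℂ) * z ^ kl.2) =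
      -- The recurrence fails at `n = 0`, where the convolution is 0 but `u 0 = 1`; this correction
      -- is the 1 in `U (1 - P) = 1`.
      (u n : ℂ) * z ^ n - if n = 0 then 1 else 0 := by
    intro n
    have : ∀ kl ∈ Finset.HasAntidiagonal.antidiagonal n,
        (p kl.1 : ℂ) * z ^ kl.1 * ((u kl.2 : ℂ) * z ^ kl.2) =
        ((p kl.1 * u kl.2 : ℝ) : ℂ) * z ^ n := by
      intro kl hkl
      rw [← Finset.HasAntidiagonal.mem_antidiagonal.1 hkl, pow_add]
      push_cast
      ring
    rw [Finset.sum_congr rfl this, ← Finset.sum_mul, ← Complex.ofReal_sum]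
    rcases Nat.eq_zero_or_pos n with rfl | hn
    · simp [h0, hu0]
    · rw [← hu n hn, if_neg hn.ne', sub_zero]
  simp only [hcoef] at hprod
  rw [(hU.of_norm.hasSum.sub (hasSum_ite_eq 0 (1 : ℂ))).tsum_eq] at hprod
  linear_combination -hprod

/-- The renewal theorem for an aperiodic distribution with an exponential moment. -/
theorem tendsto_renewal {p u : ℕ → ℝ} (hp : ∀ k, 0 ≤ p k) (h0 : p 0 = 0) (hp1 : HasSum p 1)
    (haper : ∀ d, 2 ≤ d → ∃ k, p k ≠ 0 ∧ ¬ d ∣ k) {s : ℝ} (hs1 : 1 < s)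
    (hs : Summable fun k => p k * s ^ k) (hu0 : u 0 = 1) (hu : ∀ n, 0 < n →
      u n = ∑ kl ∈ Finset.HasAntidiagonal.antidiagonal n, p kl.1 * u kl.2) :
    Filter.Tendsto u Filter.atTop (nhds (∑' k : ℕ, p k * k)⁻¹) := by
  set P : ℂ → ℂ := fun z => ∑' k, (p k : ℂ) * z ^ k with hPdef
  have hsn : Summable fun k => ‖(p k : ℂ)‖ * s ^ k := by
    simpa only [Complex.norm_real, Real.norm_of_nonneg (hp _)] using hs
  have hderiv : ∀ z : ℂ, ‖z‖ < s →
      HasDerivAt P (∑' k : ℕ, (p k : ℂ) * (k * z ^ (k - 1))) z := fun z hz =>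
    hasDerivAt_tsum_mul_pow hsn hz
  have hPsum : ∀ z : ℂ, ‖z‖ ≤ 1 → HasSum (fun k => (p k : ℂ) * z ^ k) (P z) := by
    intro z hz
    refine (Summable.of_norm_bounded hp1.summable fun k => ?_).hasSum
    rw [norm_mul, norm_pow, Complex.norm_real, Real.norm_of_nonneg (hp k)]
    exact mul_le_of_le_one_right (hp k) (pow_le_one₀ (norm_nonneg z) hz)
  have hP1 : P 1 = 1 := by
    refine (hPsum 1 (by simp)).unique ?_
    simpa using Complex.hasSum_ofReal.2 hp1
  set μ : ℝ := ∑' k : ℕ, p k * k with hμ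
  have hP'1 : deriv P 1 = μ := by
    rw [(hderiv 1 (by simpa using hs1)).deriv, hμ, Complex.ofReal_tsum]
    simp
  have hsumμ : Summable fun k : ℕ => p k * k := by
    simpa using summable_mul_nat_mul_pow hp zero_le_one hs1 hs
  have hμ1 : 1 ≤ μ := by
    refine hasSum_le (fun k => ?_) hp1 hsumμ.hasSum
    rcases Nat.eq_zero_or_pos k with rfl | hk
    · simp [h0]
    · exact le_mul_of_one_le_right (hp k) (by exact_mod_cast hk)
  -- `Q` is `(1 - P) / (1 - z)` with its singularity at 1 removed. Since `U (1 - P) = 1`, the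
  -- differences of `u` are the coefficients of `(1 - z) U = 1 / Q`.
  set Q : ℂ → ℂ := dslope P 1 with hQdef
  have hQ1 : Q 1 = μ := by rw [hQdef, dslope_same, hP'1]
  have hQmul : ∀ z, (1 - z) * Q z = 1 - P z := by
    intro z
    have := sub_smul_dslope P 1 z
    rw [hP1, smul_eq_mul] at this
    linear_combination -this
  have hQdiff : DifferentiableOn ℂ Q (Metric.ball 0 s) := by
    rw [hQdef, Complex.differentiableOn_dslope (Metric.isOpen_ball.mem_nhds (by simpa using hs1))]
    exact fun z hz => (hderiv z (by simpa using hz)).differentiableAt.differentiableWithinAt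
  have hQne : ∀ z : ℂ, ‖z‖ ≤ 1 → Q z ≠ 0 := by
    intro z hz hQ0
    rcases eq_or_ne z 1 with rfl | hz1
    · rw [hQ1, Complex.ofReal_eq_zero] at hQ0
      linarith
    · have h1 := hQmul z
      rw [hQ0, mul_zero, eq_comm, sub_eq_zero] at h1
      exact hz1 (eq_one_of_tsum_mul_pow_eq_one hp h0 hp1 haper hz (h1 ▸ hPsum z hz))
  -- By compactness, `Q` remains analytic and zero-free on a disc of radius greater than 1.
  obtain ⟨δ, hδ, hsub⟩ := (isCompact_closedBall (0 : ℂ) 1).exists_thickening_subset_open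
    (hQdiff.continuousOn.isOpen_inter_preimage Metric.isOpen_ball isOpen_compl_singleton)
    (fun z hz => by
      rw [mem_closedBall_zero_iff] at hz
      exact ⟨by rw [mem_ball_zero_iff]; linarith, hQne z hz⟩ :
      Metric.closedBall (0 : ℂ) 1 ⊆ Metric.ball 0 s ∩ Q ⁻¹' {0}ᶜ)
  rw [thickening_closedBall hδ zero_le_one] at hsub
  let r : NNReal := ⟨1 + δ / 2, by positivity⟩
  have hr1 : (1 : ℝ) < r := by
    change 1 < 1 + δ / 2
    linarith
  have hrsub : Metric.closedBall (0 : ℂ) r ⊆ Metric.ball 0 s ∩ Q ⁻¹' {0}ᶜ := by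
    refine (Metric.closedBall_subset_ball ?_).trans hsub
    change 1 + δ / 2 < _
    linarith
  have hpow : HasFPowerSeriesOnBall (fun z => (Q z)⁻¹)
      (cauchyPowerSeries (fun z => (Q z)⁻¹) 0 r) 0 r := by
    refine DifferentiableOn.hasFPowerSeriesOnBall ?_ (by exact_mod_cast zero_lt_one.trans hr1)
    exact (hQdiff.mono fun z hz => (hrsub hz).1).fun_inv fun z hz => (hrsub hz).2
  let b : ℕ → ℂ := fun n => u n - if n = 0 then 0 else (u (n - 1) : ℂ)
  have hb : HasFPowerSeriesAt (fun z => (Q z)⁻¹) (FormalMultilinearSeries.ofScalars ℂ b) 0 := by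
    rw [hasFPowerSeriesAt_iff]
    filter_upwards [Metric.ball_mem_nhds (0 : ℂ) zero_lt_one] with z hz
    rw [mem_ball_zero_iff] at hz
    obtain ⟨hsU, hUP⟩ := renewal_mul_one_sub hp h0 hp1 hu0 hu hz
    set U := ∑' n, (u n : ℂ) * z ^ n with hU
    have hinv : (Q (0 + z))⁻¹ = U - z * U := by
      rw [zero_add, eq_comm]
      refine eq_inv_of_mul_eq_one_left ?_
      rw [← hUP]
      change _ = U * (1 - P z)
      rw [← hQmul]
      ring
    have hshift : HasSum (fun n => (if n = 0 then 0 else (u (n - 1) : ℂ)) * z ^ n) (z * U) := by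
      rw [← hasSum_nat_add_iff' 1]
      simp only [Finset.range_one, Finset.sum_singleton, if_true, zero_mul, sub_zero]
      refine (hsU.hasSum.mul_left z).congr_fun fun n => ?_
      simp [pow_succ]
      ring
    rw [hinv]
    refine (hsU.hasSum.sub hshift).congr_fun fun n => ?_
    rw [FormalMultilinearSeries.coeff_ofScalars, smul_eq_mul]
    simp only [b]
    ring
  -- The series of `1 / Q` converges at `z = 1`, and its partial sums there telescope to `u n`.
  have hsumb : HasSum b (μ : ℂ)⁻¹ := by
    have h1 := hpow.hasSum (y := 1) (by
      rw [Metric.eball_coe, mem_ball_zero_iff]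
      simpa using hr1)
    rw [hpow.hasFPowerSeriesAt.eq_formalMultilinearSeries hb] at h1
    simp only [FormalMultilinearSeries.ofScalars_apply_eq, zero_add, hQ1] at h1
    simpa using h1
  have hpartial : ∀ n, ∑ k ∈ Finset.range (n + 1), b k = u n := by
    intro n
    induction n with
    | zero => simp [b]
    | succ n ih =>
      rw [Finset.sum_range_succ, ih]
      simp [b]
  have hlim := hsumb.tendsto_sum_nat.comp (Filter.tendsto_add_atTop_nat 1)
  have hlim' : Filter.Tendsto (fun n => (u n : ℂ)) Filter.atTop (nhds ((μ⁻¹ : ℝ) : ℂ)) := by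
    rw [Complex.ofReal_inv]
    exact hlim.congr hpartial
  exact (Complex.continuous_re.tendsto _).comp hlim'

/-- The renewal sequence, convolved with the size-biased distribution. -/
theorem tendsto_sum_nat_mul_renewal {p u : ℕ → ℝ} (hp : ∀ k, 0 ≤ p k)
    (hs : Summable fun k : ℕ => p k * k) (hu : ∀ n, 0 ≤ u n ∧ u n ≤ 1) {c : ℝ}
    (hlim : Filter.Tendsto u Filter.atTop (nhds c)) :
    Filter.Tendsto (fun n => ∑ kl ∈ Finset.HasAntidiagonal.antidiagonal n,
      kl.1 * p kl.1 * u kl.2) Filter.atTop (nhds ((∑' k : ℕ, p k * k) * c)) := by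
  -- Extending by zero to a sum over all `k` allows dominated convergence, with bound `p k * k`.
  have h : ∀ n, ∑ kl ∈ Finset.HasAntidiagonal.antidiagonal n, kl.1 * p kl.1 * u kl.2 =
      ∑' k : ℕ, if k ≤ n then p k * k * u (n - k) else 0 := by
    intro n
    rw [Finset.Nat.sum_antidiagonal_eq_sum_range_succ_mk, tsum_eq_sum (s := Finset.range (n + 1))]
    · refine Finset.sum_congr rfl fun k hk => ?_
      rw [if_pos (by simpa [Nat.lt_succ_iff] using hk), mul_comm (k : ℝ)]
    · intro k hk
      rw [if_neg (by simpa [Nat.lt_succ_iff] using hk)]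
  simp only [h]
  rw [← tsum_mul_right]
  refine tendsto_tsum_of_dominated_convergence hs (fun k => ?_) (Filter.Eventually.of_forall
    fun n k => ?_)
  · have h1 : Filter.Tendsto (fun n => p k * k * u (n - k)) Filter.atTop (nhds (p k * k * c)) :=
      (hlim.comp (Filter.tendsto_sub_atTop_nat k)).const_mul _
    refine h1.congr' ?_
    filter_upwards [Filter.eventually_ge_atTop k] with n hn
    rw [if_pos hn]
  · have hnn : 0 ≤ p k * k := mul_nonneg (hp k) (Nat.cast_nonneg k)
    split_ifs
    · rw [Real.norm_of_nonneg (mul_nonneg hnn (hu _).1)]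
      exact mul_le_of_le_one_right hnn (hu _).2
    · simpa using hnn
-- Radius of convergence and the root of `G = 1`.
open PowerSeries

theorem coeff_genFun (C : Set FinPerm) (n : ℕ) : coeff n (genFun C) = count C n :=
  coeff_mk _ _

/-- Only the case `m = 0` of aperiodicity is needed: a support inside the multiples of `d` makes `G`
a series in `x ^ d`. -/
theorem Aperiodic.exists_not_dvd {G : PowerSeries ℝ} (h : Aperiodic G) (d : ℕ) (hd : 2 ≤ d) :
    ∃ k, coeff k G ≠ 0 ∧ ¬ d ∣ k := by
  by_contra! hall
  refine h ⟨0, d, hd, by omega, PowerSeries.mk fun n => coeff (d * n) G, ?_⟩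
  ext k
  rw [pow_zero, one_mul, coeff_expand]
  split_ifs with hdvd
  · rw [coeff_mk, Nat.mul_div_cancel' hdvd]
  · by_contra hk
    exact hdvd (hall k hk)

theorem summable_of_lt_radius {G : PowerSeries ℝ} {x : ℝ} (hx : 0 ≤ x)
    (h : ENNReal.ofReal x < radius G) : Summable fun n => ‖coeff n G‖ * x ^ n := by
  have := FormalMultilinearSeries.summable_norm_mul_pow _ h
  simpa [FormalMultilinearSeries.ofScalars_norm, hx] using this

theorem le_radius_of_le {G : PowerSeries ℝ} {x B : ℝ} (hx : 0 ≤ x)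
    (h : ∀ n, ‖coeff n G‖ * x ^ n ≤ B) : ENNReal.ofReal x ≤ radius G := by
  refine FormalMultilinearSeries.le_radius_of_bound _ B fun n => ?_
  rw [FormalMultilinearSeries.ofScalars_norm, Real.coe_toNNReal x hx]
  exact h n

theorem Supercritical.exists_one_lt_evalAt {G : PowerSeries ℝ} (h : Supercritical G) :
    ∃ x : ℝ, 0 < x ∧ ENNReal.ofReal x < radius G ∧ 1 < evalAt G x := by
  obtain ⟨hpos, τ, hτ, h1⟩ := h
  have hpos' : (0 : EReal) < (radius G : EReal) := by exact_mod_cast hpos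
  obtain ⟨t, ht, hsub⟩ := Filter.mem_comap.1 (hτ.eventually (lt_mem_nhds h1))
  obtain ⟨l, hl, hlt⟩ := (mem_nhdsLT_iff_exists_Ioo_subset' hpos').1 ht
  -- The maximum with 0 forces the chosen point to be positive.
  obtain ⟨x, hlx, hxr⟩ := EReal.lt_iff_exists_real_btwn.1 (max_lt hpos' hl)
  obtain ⟨hx0, hlx⟩ := max_lt_iff.1 hlx
  have hx0' : 0 < x := by exact_mod_cast hx0
  refine ⟨x, hx0', ?_, ?_⟩
  · rw [← EReal.coe_ennreal_lt_coe_ennreal_iff, EReal.coe_ennreal_ofReal, max_eq_left hx0'.le]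
    exact hxr
  · have h2 : (1 : EReal) < (evalAt G x : EReal) := hsub (hlt ⟨hlx, hxr⟩)
    exact_mod_cast h2

theorem exists_hasSum_mul_pow_eq_one {a : ℕ → ℝ} (h0 : a 0 = 0) {s : ℝ}
    (hs : Summable fun k => ‖a k‖ * s ^ k) {x : ℝ} (hx : 0 < x) (hxs : x < s)
    (h1 : 1 < ∑' k, a k * x ^ k) : ∃ ρ, 0 < ρ ∧ ρ < x ∧ HasSum (fun k => a k * ρ ^ k) 1 := by
  have hcont : ContinuousOn (fun y => ∑' k, a k * y ^ k) (Set.Icc 0 x) := fun y hy =>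
    (hasDerivAt_tsum_mul_pow hs (by
      rw [Real.norm_of_nonneg hy.1]
      exact hy.2.trans_lt hxs)).continuousAt.continuousWithinAt
  have hzero : ∑' k, a k * (0 : ℝ) ^ k = 0 := by
    rw [← tsum_zero (β := ℕ)]
    refine tsum_congr fun k => ?_
    rcases Nat.eq_zero_or_pos k with rfl | hk
    · simp [h0]
    · simp [hk.ne']
  obtain ⟨ρ, hρ, hρ1⟩ := intermediate_value_Ioo hx.le hcont
    (show (1 : ℝ) ∈ Set.Ioo _ _ from ⟨by simp only [hzero, zero_lt_one], h1⟩)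
  refine ⟨ρ, hρ.1, hρ.2, ?_⟩
  simp only at hρ1
  rw [← hρ1]
  refine (Summable.of_norm_bounded hs fun k => ?_).hasSum
  have : ρ ≤ s := (hρ.2.trans hxs).le
  rw [norm_mul, norm_pow, Real.norm_of_nonneg hρ.1.le]
  have := hρ.1.le
  gcongr

theorem hasSum_mul_pow_lt {a : ℕ → ℝ} (ha : ∀ k, 0 ≤ a k) (h0 : a 0 = 0) {x y A B : ℝ}
    (hx : 0 < x) (hxy : x < y) (hA : HasSum (fun k => a k * x ^ k) A)
    (hB : HasSum (fun k => a k * y ^ k) B) (hA0 : A ≠ 0) : A < B := by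
  have hex : ∃ k, a k ≠ 0 := by
    by_contra! hall
    simp only [hall, zero_mul] at hA
    exact hA0 (hA.unique hasSum_zero)
  obtain ⟨k, hk⟩ := hex
  have hk0 : k ≠ 0 := by
    rintro rfl
    exact hk h0
  exact hasSum_lt (fun j => mul_le_mul_of_nonneg_left (pow_le_pow_left₀ hx.le hxy.le j) (ha j))
    (mul_lt_mul_of_pos_left (pow_lt_pow_left₀ hxy hx.le hk0) ((ha k).lt_of_ne' hk)) hA hB

/-- Terms with a nonzero limit are bounded but not summable, which bounds the radius from both
sides. -/
theorem radius_eq_of_tendsto {F : PowerSeries ℝ} {ρ c : ℝ} (hρ : 0 < ρ) (hc : c ≠ 0)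
    (h : Filter.Tendsto (fun n => coeff n F * ρ ^ n) Filter.atTop (nhds c)) :
    radius F = ENNReal.ofReal ρ := by
  refine le_antisymm (le_of_not_gt fun hlt => ?_) ?_
  · have hsum : Summable fun n => coeff n F * ρ ^ n := by
      refine Summable.of_norm_bounded (summable_of_lt_radius hρ.le hlt) fun n => ?_
      rw [norm_mul, norm_pow, Real.norm_of_nonneg hρ.le]
    exact hc (tendsto_nhds_unique h hsum.tendsto_atTop_zero)
  · obtain ⟨B, hB⟩ := h.norm.bddAbove_range
    refine le_radius_of_le (B := B) hρ.le fun n => ?_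
    have := hB ⟨n, rfl⟩
    simpa [norm_mul, abs_of_pos hρ] using this

end AffinePermutation

/-! ### The main theorem. -/

open AffinePermutation in
theorem theorem4p4 (C : Set FinPerm) (hC : IsPermClass C) (hsum : SumClosed C)
    (hsuper : Supercritical (genFun (indec C))) (haper : Aperiodic (genFun (indec C))) :
    ∃ ρ : ℝ,
      -- `ρ` is the unique positive root of `G(x) = 1`, interior to the disc of convergence of `G`
      (0 < ρ ∧ HasSum (fun n => (count (indec C) n : ℝ) * ρ ^ n) 1) ∧
      (∀ x : ℝ, 0 < x → HasSum (fun n => (count (indec C) n : ℝ) * x ^ n) 1 → x = ρ) ∧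
      ENNReal.ofReal ρ < radius (genFun (indec C)) ∧
      -- `ρ` is the radius of convergence of `F`
      radius (genFun C) = ENNReal.ofReal ρ ∧
      -- the two asymptotic equivalences, with `α⁻¹ = ρ G'(ρ)`
      Asymptotics.IsEquivalent Filter.atTop
        (fun n : ℕ => (affCount C n : ℝ))
        (fun n : ℕ => ρ * deriv (evalAt (genFun (indec C))) ρ * (count C n : ℝ)) ∧
      Asymptotics.IsEquivalent Filter.atTop
        (fun n : ℕ => ρ * deriv (evalAt (genFun (indec C))) ρ * (count C n : ℝ))
        (fun n : ℕ => (ρ ^ n)⁻¹) := by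
  obtain ⟨x, hx0, hxr, hx1⟩ := hsuper.exists_one_lt_evalAt
  -- The extra radius `s` gives differentiability up to `x` and, as `s / ρ > 1`, the exponential
  -- moment of `p`.
  obtain ⟨s, hs0, hxs, hsr⟩ := ENNReal.lt_iff_exists_real_btwn.1 hxr
  have hxs' : x < s := by
    by_contra! hle
    exact absurd hxs (ENNReal.ofReal_le_ofReal hle).not_gt
  set g : ℕ → ℝ := fun n => (count (indec C) n : ℝ) with hg
  have hg_nonneg : ∀ k, 0 ≤ g k := fun k => Nat.cast_nonneg _
  have hg0 : g 0 = 0 := by simp [hg, count_indec_zero]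
  have hgs : Summable fun k => ‖g k‖ * s ^ k := by
    simpa only [coeff_genFun] using summable_of_lt_radius hs0 hsr
  have hGeval : evalAt (genFun (indec C)) = fun y => ∑' k, g k * y ^ k := by
    funext y
    simp only [evalAt, coeff_genFun, hg]
  rw [hGeval] at hx1
  obtain ⟨ρ, hρ0, hρx, hρ1⟩ := exists_hasSum_mul_pow_eq_one hg0 hgs hx0 hxs' hx1
  have hρs : ρ < s := hρx.trans hxs'
  have hderiv : deriv (evalAt (genFun (indec C))) ρ = ∑' k : ℕ, g k * (k * ρ ^ (k - 1)) := by
    rw [hGeval]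
    refine (hasDerivAt_tsum_mul_pow hgs ?_).deriv
    rwa [Real.norm_of_nonneg hρ0.le]
  set p : ℕ → ℝ := fun k => g k * ρ ^ k with hpdef
  set u : ℕ → ℝ := fun n => (count C n : ℝ) * ρ ^ n with hudef
  have hp : ∀ k, 0 ≤ p k := fun k => mul_nonneg (hg_nonneg k) (by positivity)
  have hp0 : p 0 = 0 := by simp [hpdef, hg0]
  have hpaper : ∀ d, 2 ≤ d → ∃ k, p k ≠ 0 ∧ ¬ d ∣ k := by
    intro d hd
    obtain ⟨k, hk, hdvd⟩ := haper.exists_not_dvd d hd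
    rw [coeff_genFun] at hk
    exact ⟨k, mul_ne_zero hk (by positivity), hdvd⟩
  have hps : Summable fun k => p k * (s / ρ) ^ k := by
    refine hgs.congr fun k => ?_
    rw [hpdef, Real.norm_of_nonneg (hg_nonneg k)]
    rw [mul_assoc, ← mul_pow, mul_div_cancel₀ _ hρ0.ne']
  have hsρ : 1 < s / ρ := (one_lt_div hρ0).2 hρs
  -- An empty class would have `G = 0`, which is not aperiodic.
  have hne : C.Nonempty := by
    by_contra hempty
    rw [Set.not_nonempty_iff_eq_empty] at hempty
    obtain ⟨k, hk, -⟩ := hpaper 2 le_rfl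
    refine hk ?_
    simp [hpdef, hg, count, indec, hempty]
  have hu0 : u 0 = 1 := by simp [hudef, count_zero hC hne]
  -- Weight `1` rescales the recurrence for `C`, weight `k` the one for `⊕ C`.
  have hconv : ∀ (n : ℕ) (w : ℕ → ℝ),
      (∑ kl ∈ Finset.HasAntidiagonal.antidiagonal n, w kl.1 * g kl.1 * count C kl.2) * ρ ^ n =
      ∑ kl ∈ Finset.HasAntidiagonal.antidiagonal n, w kl.1 * p kl.1 * u kl.2 := by
    intro n w
    rw [Finset.sum_mul]
    refine Finset.sum_congr rfl fun kl hkl => ?_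
    rw [← Finset.HasAntidiagonal.mem_antidiagonal.1 hkl, pow_add]
    simp only [hpdef, hudef]
    ring
  have hu : ∀ n, 0 < n →
      u n = ∑ kl ∈ Finset.HasAntidiagonal.antidiagonal n, p kl.1 * u kl.2 := by
    intro n hn
    have := hconv n fun _ => 1
    simp only [one_mul] at this
    rw [← this]
    simp only [hudef, hg]
    rw [count_eq_sum_indec hC hsum hn]
    push_cast
    rfl
  have hsumμ : Summable fun k : ℕ => p k * k := by
    simpa using summable_mul_nat_mul_pow hp zero_le_one hsρ hps
  set μ : ℝ := ∑' k : ℕ, p k * k with hμ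
  have hμG : ρ * deriv (evalAt (genFun (indec C))) ρ = μ := by
    rw [hderiv, ← tsum_mul_left, hμ]
    refine tsum_congr fun k => ?_
    rcases k with _ | k
    · simp
    · simp only [hpdef, Nat.add_sub_cancel, pow_succ]
      ring
  have hμpos : 0 < μ := by
    refine zero_lt_one.trans_le (hasSum_le (fun k => ?_) hρ1 hsumμ.hasSum)
    rcases Nat.eq_zero_or_pos k with rfl | hk
    · simp [hp0]
    · exact le_mul_of_one_le_right (hp k) (by exact_mod_cast hk)
  have hulim : Filter.Tendsto u Filter.atTop (nhds μ⁻¹) :=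
    tendsto_renewal hp hp0 hρ1 hpaper hsρ hps hu0 hu
  have hequivF : Asymptotics.IsEquivalent Filter.atTop (fun n : ℕ => μ * (count C n : ℝ))
      (fun n : ℕ => (ρ ^ n)⁻¹) := by
    refine Asymptotics.isEquivalent_of_tendsto_one ?_
    have := hulim.const_mul μ
    rw [mul_inv_cancel₀ hμpos.ne'] at this
    refine this.congr fun n => ?_
    simp [hudef, mul_assoc]
  have hequivA : Asymptotics.IsEquivalent Filter.atTop (fun n : ℕ => (affCount C n : ℝ))
      (fun n : ℕ => (ρ ^ n)⁻¹) := by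
    refine Asymptotics.isEquivalent_of_tendsto_one ?_
    have := tendsto_sum_nat_mul_renewal hp hsumμ (renewal_mem_Icc hp hp0 hρ1 hu0 hu) hulim
    rw [← hμ, mul_inv_cancel₀ hμpos.ne'] at this
    refine this.congr' ?_
    filter_upwards [Filter.eventually_gt_atTop 0] with n hn
    rw [← hconv n fun k => (k : ℝ), Pi.div_apply, div_inv_eq_mul,
      affCount_eq_sum_indec hC hsum hn]
    push_cast
    rfl
  refine ⟨ρ, ⟨hρ0, hρ1⟩, fun y hy hy1 => ?_, ?_, ?_, ?_, ?_⟩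
  · rcases lt_trichotomy y ρ with hlt | heq | hlt
    · exact absurd (hasSum_mul_pow_lt hg_nonneg hg0 hy hlt hy1 hρ1 one_ne_zero) (lt_irrefl _)
    · exact heq
    · exact absurd (hasSum_mul_pow_lt hg_nonneg hg0 hρ0 hlt hρ1 hy1 one_ne_zero) (lt_irrefl _)
  · exact (ENNReal.ofReal_le_ofReal hρx.le).trans_lt hxr
  · refine radius_eq_of_tendsto hρ0 (inv_ne_zero hμpos.ne') ?_
    simpa only [coeff_genFun] using hulim
  · rw [hμG]
    exact hequivA.trans hequivF.symm
  · rw [hμG]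
    exact hequivF
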